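/- Let $m\ge 1$ and let $M$ be a smooth $(2m+1)$-dimensional manifold with a Kenmotsu structure $(\varphi,\xi,\eta,g)$: $g$ is a Riemannian metric on $M$, $\varphi$ is a smooth $(1,1)$-tensor field, $\xi$ (the Reeb vector field) a smooth vector field and $\eta$ a smooth $1$-form with $$\varphi\xi=0,\quad \eta(\xi)=1,\quad \varphi^2=-I+\eta\otimes\xi,\quad g(\varphi E,\varphi F)=g(E,F)-\eta(E)\eta(F),$$ the structure is normal, $[\varphi,\varphi]+2\,d\eta\otimes\xi=0$, and $(\nabla_E\varphi)F=g(\varphi E,F)\,\xi-\eta(F)\,\varphi E$ for all vector fields $E,F$, where $\nabla$ is the Levi-Civita connection of $g$. Let $\pi$ be a Riemannian submersion from $(M,g)$ onto a Riemannian manifold $(N,g_N)$ with $\dim N<\dim M$. Assume that $\pi$ is anti-invariant, i.e. $\varphi(\ker\pi_*)\subseteq(\ker\pi_*)^{\perp}$, and that $\xi$ is either everywhere vertical (tangent to $\ker\pi_*$) or everywhere horizontal (orthogonal to $\ker\pi_*$). Let $f:M\to\mathbb R$ be a differentiable function such that $\pi$ is a Clairaut submersion with $r=e^{f}$: for every geodesic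 $\alpha$ of $M$, defined on an open interval, the function $t\mapsto e^{f(\alpha(t))}\sin\theta(t)$ is constant, where $\theta(t)$ is the angle between $\dot\alpha(t)$ and the horizontal space $(\ker\pi_{*})^{\perp}$ at $\alpha(t)$. Then $$g(\nabla f,\xi)=1$$ at every point of $M$, where $\nabla f$ is the gradient of $f$ with respect to $g$. -/

import Mathlib

open Bundle
open scoped Manifold ContDiff

noncomputable section

namespace KenmotsuSubmersion

section Riemannian

variable {d : ℕ} {M : Type*} [TopologicalSpace M] [ChartedSpace (EuclideanSpace ℝ (Fin d)) M]
  [IsManifold (𝓡 d) ∞ M]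

/-- Smooth vector fields on a `d`-dimensional manifold. -/
def IsSmoothVectorField (X : ∀ p : M, TangentSpace (𝓡 d) p) : Prop :=
  ContMDiff (𝓡 d) (𝓡 d).tangent ∞ (fun p : M ↦ (⟨p, X p⟩ : TangentBundle (𝓡 d) M))

variable [RiemannianBundle (fun p : M ↦ TangentSpace (𝓡 d) p)]

instance (p : M) : FiniteDimensional ℝ (TangentSpace (𝓡 d) p) :=
  inferInstanceAs (FiniteDimensional ℝ (EuclideanSpace ℝ (Fin d)))

instance (p : M) : CompleteSpace (TangentSpace (𝓡 d) p) :=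
  FiniteDimensional.complete ℝ (TangentSpace (𝓡 d) p)

/-- The gradient of a real function with respect to the Riemannian metric:
`g (grad f) v = df v`. -/
def grad (f : M → ℝ) (p : M) : TangentSpace (𝓡 d) p :=
  (InnerProductSpace.toDual ℝ (TangentSpace (𝓡 d) p)).symm (mvfderiv (𝓡 d) f p)

/-- The Riemannian metric read in the chart around `c`, at the point `x` of the chart's target:
`(v, w) ↦ g (dψ v) (dψ w)`, with `ψ` the inverse of the chart; its matrix is `(g_ij x)`. -/
def metricInChart (c : M) (x : EuclideanSpace ℝ (Fin d)) :
    EuclideanSpace ℝ (Fin d) →L[ℝ] EuclideanSpace ℝ (Fin d) →L[ℝ] ℝ :=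
  let A : EuclideanSpace ℝ (Fin d) →L[ℝ] TangentSpace (𝓡 d) ((extChartAt (𝓡 d) c).symm x) :=
    mfderiv (𝓡 d) (𝓡 d) (extChartAt (𝓡 d) c).symm x
  (innerSL ℝ (E := TangentSpace (𝓡 d) ((extChartAt (𝓡 d) c).symm x))).bilinearComp A A

/-- The Christoffel symbols of the first kind of the metric in the chart around `c`:
`Γ (a, b; e) = (∂_a g(b, e) + ∂_b g(a, e) - ∂_e g(a, b)) / 2`, a linear form in `e`. -/
def christoffel (c : M) (x a b : EuclideanSpace ℝ (Fin d)) :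
    EuclideanSpace ℝ (Fin d) →L[ℝ] ℝ :=
  let D := fderiv ℝ (metricInChart c) x
  (1 / 2 : ℝ) • (D a b + D b a - (D.flip a).flip b)

/-- The Levi-Civita derivative `∇_v Y` at the point `p`, computed in the chart around `p`: the
vector `z` at `p` such that `g(z, w) = g(∂_v Y, w) + Γ (v, Y; w)` for all `w`. -/
def covDeriv (Y : ∀ p : M, TangentSpace (𝓡 d) p) (p : M) (v : TangentSpace (𝓡 d) p) :
    TangentSpace (𝓡 d) p :=
  let ch := extChartAt (𝓡 d) p
  let x : EuclideanSpace ℝ (Fin d) := ch p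
  let Dch : TangentSpace (𝓡 d) p →L[ℝ] EuclideanSpace ℝ (Fin d) :=
    mfderiv (𝓡 d) (𝓡 d) ch p
  let Yc : EuclideanSpace ℝ (Fin d) → EuclideanSpace ℝ (Fin d) :=
    fun y ↦ mfderiv (𝓡 d) (𝓡 d) ch (ch.symm y) (Y (ch.symm y))
  (InnerProductSpace.toDual ℝ (TangentSpace (𝓡 d) p)).symm
    ((metricInChart p x (fderiv ℝ Yc x (Dch v)) + christoffel p x (Dch v) (Yc x)).comp Dch)

/-- The velocity `α'(t)`. -/
def velocity (α : ℝ → M) (t : ℝ) : TangentSpace (𝓡 d) (α t) :=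
  mfderiv 𝓘(ℝ, ℝ) (𝓡 d) α t (1 : ℝ)

/-- `α` is a geodesic on the open set `s` of parameters: a `C^2` curve (hence a smooth one) such
that, around each parameter, `∇_{α'} α' = 0` holds in local coordinates `u` on `M`, i.e.
`g(u'', w) + Γ (u', u'; w) = 0` for all `w`. The equation does not depend on the chart. -/
structure IsGeodesicOn (α : ℝ → M) (s : Set ℝ) : Prop where
  contMDiffOn : ContMDiffOn 𝓘(ℝ, ℝ) (𝓡 d) 2 α s
  geodesic_eq : ∀ t ∈ s, ∃ c : M, α t ∈ (extChartAt (𝓡 d) c).source ∧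
    let u : ℝ → EuclideanSpace ℝ (Fin d) := fun τ ↦ extChartAt (𝓡 d) c (α τ)
    metricInChart c (u t) (deriv (deriv u) t) + christoffel c (u t) (deriv u t) (deriv u t) = 0

variable (d M) in
/-- An almost contact metric structure `(φ, ξ, η, g)`, where `g` is the given Riemannian metric. -/
structure AlmostContactMetricStructure where
  phi : ∀ p : M, TangentSpace (𝓡 d) p →L[ℝ] TangentSpace (𝓡 d) p
  xi : ∀ p : M, TangentSpace (𝓡 d) p
  eta : ∀ p : M, TangentSpace (𝓡 d) p →L[ℝ] ℝ
  smooth_xi : IsSmoothVectorField xi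
  smooth_phi : ∀ X : (∀ p : M, TangentSpace (𝓡 d) p), IsSmoothVectorField X →
    IsSmoothVectorField (fun p ↦ phi p (X p))
  smooth_eta : ∀ X : (∀ p : M, TangentSpace (𝓡 d) p), IsSmoothVectorField X →
    ContMDiff (𝓡 d) 𝓘(ℝ, ℝ) ∞ (fun p ↦ eta p (X p))
  phi_xi : ∀ p, phi p (xi p) = 0
  eta_xi : ∀ p, eta p (xi p) = 1
  phi_phi : ∀ p v, phi p (phi p v) = -v + eta p v • xi p
  inner_phi_phi : ∀ p v w,
    inner ℝ (phi p v) (phi p w) = inner ℝ v w - eta p v * eta p w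

namespace AlmostContactMetricStructure

variable (S : AlmostContactMetricStructure d M)

/-- The Nijenhuis tensor `[φ, φ](X, Y) = φ²[X, Y] + [φX, φY] - φ[φX, Y] - φ[X, φY]`. -/
def nijenhuis (X Y : ∀ p : M, TangentSpace (𝓡 d) p) (p : M) : TangentSpace (𝓡 d) p :=
  let br := VectorField.mlieBracket (𝓡 d) (M := M)
  let φX : ∀ q : M, TangentSpace (𝓡 d) q := fun q ↦ S.phi q (X q)
  let φY : ∀ q : M, TangentSpace (𝓡 d) q := fun q ↦ S.phi q (Y q)
  S.phi p (S.phi p (br X Y p)) + br φX φY p - S.phi p (br φX Y p) - S.phi p (br X φY p)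

/-- `2 dη(X, Y) = X (η Y) - Y (η X) - η [X, Y]`. -/
def twoDEta (X Y : ∀ p : M, TangentSpace (𝓡 d) p) (p : M) : ℝ :=
  mvfderiv (𝓡 d) (fun q ↦ S.eta q (Y q)) p (X p)
    - mvfderiv (𝓡 d) (fun q ↦ S.eta q (X q)) p (Y p)
    - S.eta p (VectorField.mlieBracket (𝓡 d) X Y p)

/-- Normality: `[φ, φ] + 2 dη ⊗ ξ = 0`. -/
def IsNormal : Prop :=
  ∀ X Y : (∀ p : M, TangentSpace (𝓡 d) p), IsSmoothVectorField X → IsSmoothVectorField Y →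
    ∀ p, S.nijenhuis X Y p + S.twoDEta X Y p • S.xi p = 0

/-- Kenmotsu structures: normal, with `(∇_E φ) F = g(φ E, F) ξ - η(F) φ E`, where
`(∇_E φ) F = ∇_E (φ F) - φ (∇_E F)`, for all
smooth `F` and all tangent vectors `E`. -/
structure IsKenmotsu : Prop where
  normal : S.IsNormal
  nabla_phi : ∀ F : (∀ p : M, TangentSpace (𝓡 d) p), IsSmoothVectorField F →
    ∀ (p : M) (e : TangentSpace (𝓡 d) p),
      covDeriv (fun q ↦ S.phi q (F q)) p e - S.phi p (covDeriv F p e) =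
        inner ℝ (S.phi p e) (F p) • S.xi p - S.eta p (F p) • S.phi p e

end AlmostContactMetricStructure

end Riemannian

section Submersion

variable {d n : ℕ}
  {M : Type*} [TopologicalSpace M] [ChartedSpace (EuclideanSpace ℝ (Fin d)) M]
  [IsManifold (𝓡 d) ∞ M]
  {N : Type*} [TopologicalSpace N] [ChartedSpace (EuclideanSpace ℝ (Fin n)) N]

/-- The vertical space `ker pr_*` at `p`. -/
def vertical (pr : M → N) (p : M) : Submodule ℝ (TangentSpace (𝓡 d) p) :=
  LinearMap.ker (mfderiv (𝓡 d) (𝓡 n) pr p : TangentSpace (𝓡 d) p →ₗ[ℝ] TangentSpace (𝓡 n) (pr p))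

variable [RiemannianBundle (fun p : M ↦ TangentSpace (𝓡 d) p)]

/-- The horizontal space `(ker pr_*)^⊥` at `p`. -/
def horizontal (pr : M → N) (p : M) : Submodule ℝ (TangentSpace (𝓡 d) p) :=
  (vertical (d := d) (n := n) pr p)ᗮ

/-- The angle between the tangent vector `v` and the horizontal space at `p`, i.e. the angle
between `v` and its orthogonal projection to that space (`π / 2` if the projection is zero). -/
def horizontalAngle (pr : M → N) (p : M) (v : TangentSpace (𝓡 d) p) : ℝ :=
  InnerProductGeometry.angle v ((horizontal (d := d) (n := n) pr p).starProjection v)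

/-- `pr` satisfies the Clairaut condition with the positive function `r`: along every geodesic `α`
of `M`, defined on any open interval, `r(α) sin θ` is constant, where `θ` is the angle between
`α'` and the horizontal space. -/
structure IsClairautWith (pr : M → N) (r : M → ℝ) : Prop where
  pos : ∀ p, 0 < r p
  const : ∀ (α : ℝ → M) (s : Set ℝ), IsOpen s → s.OrdConnected → IsGeodesicOn (d := d) α s →
    ∃ C : ℝ, ∀ t ∈ s,
      r (α t) * Real.sin (horizontalAngle (d := d) (n := n) pr (α t) (velocity α t)) = C

/-- Anti-invariance: `φ (ker pr_*) ⊆ (ker pr_*)^⊥`. -/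
def IsAntiInvariant (S : AlmostContactMetricStructure d M) (pr : M → N) : Prop :=
  ∀ p, ∀ v ∈ vertical (d := d) (n := n) pr p, S.phi p v ∈ horizontal (d := d) (n := n) pr p

def HasVerticalReeb (S : AlmostContactMetricStructure d M) (pr : M → N) : Prop :=
  ∀ p, S.xi p ∈ vertical (d := d) (n := n) pr p

def HasHorizontalReeb (S : AlmostContactMetricStructure d M) (pr : M → N) : Prop :=
  ∀ p, S.xi p ∈ horizontal (d := d) (n := n) pr p

variable [RiemannianBundle (fun q : N ↦ TangentSpace (𝓡 n) q)]

/-- Riemannian submersions from a `d`-dimensional onto an `n`-dimensional manifold, `n < d`. -/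
structure IsRiemannianSubmersion (pr : M → N) : Prop where
  dim_lt : n < d
  smooth : ContMDiff (𝓡 d) (𝓡 n) ∞ pr
  surjective : Function.Surjective pr
  rank_eq : ∀ p, Function.Surjective (mfderiv (𝓡 d) (𝓡 n) pr p)
  inner_eq : ∀ p, ∀ v ∈ horizontal (d := d) (n := n) pr p,
    ∀ w ∈ horizontal (d := d) (n := n) pr p,
      inner ℝ (mfderiv (𝓡 d) (𝓡 n) pr p v) (mfderiv (𝓡 d) (𝓡 n) pr p w) = inner ℝ v w

end Submersion

end KenmotsuSubmersion

end

/-! The Kenmotsu identity for `F = ξ` gives `φ(∇_E ξ - E) = 0`, so `∇_E ξ - E` is a multiple of `ξ`.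
As `ξ` has unit length, `∇_E ξ` is orthogonal to `ξ`, hence `g(∇_E ξ, E) = |E|² - η(E)²`
(`IsKenmotsu.inner_covDeriv_xi`). The two positions of `ξ` are then treated separately.

A vertical `ξ` is impossible. For a Riemannian submersion, the Lie derivative of `g` along a
vertical field `X` vanishes on horizontal vectors, so `g(∇_v X, v) = 0` for `v` horizontal
(`inner_covDeriv_vertical_eq_zero`). With `X = ξ` the Kenmotsu identity makes this number `|v|²`,
while anti-invariance and `d ≥ 2` provide some horizontal `v ≠ 0`.

For a horizontal `ξ`, take a vertical `v ≠ 0` at `p` and the geodesic `α` with initial velocity `v +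
bξ`. Put `Q = |α'|²`, which is constant, and `y = η(α')`, whose derivative at `0` is `|v|²`.
Squared, the Clairaut relation reads `e^{2f}(Q - |hor α'|²) = C² Q`, with `hor` the horizontal
projection. Since `|hor α'|² ≥ y²`, with equality at time `0`, the function `e^{2f}(Q - y²) - C² Q`
has a minimum there. Its derivative vanishes, so `df(v + bξ) = b` (`mvfderiv_vertical_add_smul_xi`);
comparing `b = 0` with `b = 1` gives `df(ξ) = 1`.

Both cases use minima of differences that vanish at one point, so the horizontal projection is never
differentiated. The calculus is done in a chart. -/

namespace KenmotsuSubmersion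

/-! ### The geodesic equation on an open set of a vector space. -/

section LocalCalculus

variable {E : Type*} [NormedAddCommGroup E] [NormedSpace ℝ E]

/-- The Leibniz rule for a bilinear form that varies along a curve. -/
theorem hasDerivAt_bilinear {c : ℝ → E →L[ℝ] E →L[ℝ] ℝ} {c' : E →L[ℝ] E →L[ℝ] ℝ}
    {a b : ℝ → E} {a' b' : E} {t : ℝ} (hc : HasDerivAt c c' t) (ha : HasDerivAt a a' t)
    (hb : HasDerivAt b b' t) :
    HasDerivAt (fun s ↦ c s (a s) (b s))
      (c' (a t) (b t) + c t a' (b t) + c t (a t) b') t := by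
  simpa using (hc.clm_apply ha).clm_apply hb

/-- The Christoffel symbols of the first kind of a bilinear form depending on a point. -/
noncomputable def christoffelForm (g : E → E →L[ℝ] E →L[ℝ] ℝ) (x a b : E) : E →L[ℝ] ℝ :=
  (1 / 2 : ℝ) • (fderiv ℝ g x a b + fderiv ℝ g x b a - ((fderiv ℝ g x).flip a).flip b)

theorem christoffelForm_apply (g : E → E →L[ℝ] E →L[ℝ] ℝ) (x a b e : E) :
    christoffelForm g x a b e =
      (1 / 2) * (fderiv ℝ g x a b e + fderiv ℝ g x b a e - fderiv ℝ g x e a b) := by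
  simp [christoffelForm]

-- Provides the `C^1` right-hand side that Picard–Lindelöf requires of the geodesic equation.
set_option maxSynthPendingDepth 3 in
theorem contDiffOn_christoffelForm_diag [FiniteDimensional ℝ E]
    {g : E → E →L[ℝ] E →L[ℝ] ℝ} {T : Set E}
    (hT : IsOpen T) (hg : ContDiffOn ℝ ∞ g T) :
    ContDiffOn ℝ 1 (fun z : E × E ↦ christoffelForm g z.1 z.2 z.2) (T ×ˢ Set.univ) := by
  have hD : ContDiffOn ℝ 1 (fun z : E × E ↦ fderiv ℝ g z.1) (T ×ˢ Set.univ) :=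
    (hg.fderiv_of_isOpen (m := 1) hT (by norm_cast)).comp contDiff_fst.contDiffOn fun z hz ↦ hz.1
  have h2 : ContDiffOn ℝ 1 (fun z : E × E ↦ z.2) (T ×ˢ Set.univ) := contDiff_snd.contDiffOn
  rw [contDiffOn_clm_apply]
  intro e
  simp only [christoffelForm_apply]
  have he : ContDiffOn ℝ 1 (fun _ : E × E ↦ e) (T ×ˢ Set.univ) := contDiffOn_const
  exact contDiffOn_const.mul (((((hD.clm_apply h2).clm_apply h2).clm_apply he).add
    (((hD.clm_apply h2).clm_apply h2).clm_apply he)).sub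
    (((hD.clm_apply he).clm_apply h2).clm_apply h2))

/-- In finite dimension a nondegenerate form is an isomorphism onto the dual; this lets the geodesic
equation be solved for the acceleration. -/
theorem isInvertible_of_forall_eq_zero [FiniteDimensional ℝ E] (A : E →L[ℝ] E →L[ℝ] ℝ)
    (hA : ∀ a, A a = 0 → a = 0) : A.IsInvertible := by
  have hinj : Function.Injective (A : E →ₗ[ℝ] E →L[ℝ] ℝ) :=
    (injective_iff_map_eq_zero _).2 hA
  have hdim : Module.finrank ℝ E = Module.finrank ℝ (E →L[ℝ] ℝ) := by
    rw [← (LinearMap.toContinuousLinearMap (𝕜 := ℝ) (E := E) (F' := ℝ)).finrank_eq]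
    exact (Subspace.dual_finrank_eq (K := ℝ) (V := E)).symm
  refine ⟨(LinearEquiv.ofInjectiveOfFinrankEq _ hinj hdim).toContinuousLinearEquiv, ?_⟩
  ext a b
  rfl

set_option maxSynthPendingDepth 3 in
/-- Local existence of solutions of the geodesic equation of a nondegenerate bilinear form. -/
theorem exists_geodesic_local [FiniteDimensional ℝ E] {g : E → E →L[ℝ] E →L[ℝ] ℝ} {T : Set E}
    (hT : IsOpen T) (hg : ContDiffOn ℝ ∞ g T) (hinj : ∀ x ∈ T, ∀ a, g x a = 0 → a = 0)
    {x₀ : E} (hx₀ : x₀ ∈ T) (v : E) :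
    ∃ ε > 0, ∃ u w a : ℝ → E, u 0 = x₀ ∧ w 0 = v ∧
      ContDiffOn ℝ 2 u (Set.Ioo (-ε) ε) ∧
      ∀ t ∈ Set.Ioo (-ε) ε, u t ∈ T ∧ HasDerivAt u (w t) t ∧ HasDerivAt w (a t) t ∧
        g (u t) (a t) + christoffelForm g (u t) (w t) (w t) = 0 := by
  have : CompleteSpace E := FiniteDimensional.complete ℝ E
  -- The acceleration prescribed by position and velocity: `g u'' = -Γ(u', u'; ·)`.
  let G : E × E → E := fun z ↦ -(g z.1).inverse (christoffelForm g z.1 z.2 z.2)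
  have hinv : ∀ x ∈ T, (g x).IsInvertible := fun x hx ↦
    isInvertible_of_forall_eq_zero _ (hinj x hx)
  have hopen : IsOpen (T ×ˢ (Set.univ : Set E)) := hT.prod isOpen_univ
  have hG : ContDiffOn ℝ 1 G (T ×ˢ Set.univ) := by
    have h1 : ContDiffOn ℝ 1 (fun z : E × E ↦ (g z.1).inverse) (T ×ˢ Set.univ) := by
      intro z hz
      have h2 : ContDiffWithinAt ℝ 1 (fun z : E × E ↦ g z.1) (T ×ˢ Set.univ) z :=
        ((hg.of_le (by norm_cast)).comp contDiff_fst.contDiffOn fun z hz ↦ hz.1) z hz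
      exact ((hinv z.1 hz.1).contDiffAt_map_inverse).comp_contDiffWithinAt z h2
    exact (h1.clm_apply (contDiffOn_christoffelForm_diag hT hg)).neg
  let V : E × E → E × E := fun z ↦ (z.2, G z)
  have hz₀ : (x₀, v) ∈ T ×ˢ (Set.univ : Set E) := ⟨hx₀, trivial⟩
  have hV : ContDiffAt ℝ 1 V (x₀, v) :=
    contDiffAt_snd.prodMk ((hG _ hz₀).contDiffAt (hopen.mem_nhds hz₀))
  obtain ⟨r, hr, ε, hε, H⟩ :=
    hV.exists_forall_mem_closedBall_exists_eq_forall_mem_Ioo_hasDerivAt 0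
  obtain ⟨β, hβ0, hβ⟩ := H (x₀, v) (Metric.mem_closedBall_self hr.le)
  simp only [zero_sub, zero_add] at hβ
  -- The solution may leave `T`, where `g` is controlled, so the time interval is shrunk by
  -- continuity.
  have hc : ContinuousAt β 0 := (hβ 0 ⟨by linarith, hε⟩).continuousAt
  have hev : ∀ᶠ t in nhds 0, β t ∈ T ×ˢ (Set.univ : Set E) :=
    hc.eventually (by rw [hβ0]; exact hopen.mem_nhds hz₀)
  obtain ⟨δ, hδ, hδT⟩ := Metric.eventually_nhds_iff.1 hev
  have hsub : ∀ t ∈ Set.Ioo (-min ε δ) (min ε δ), t ∈ Set.Ioo (-ε) ε ∧ (β t).1 ∈ T := by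
    rintro t ⟨h1, h2⟩
    have h3 := lt_min_iff.1 h2
    have h4 := lt_min_iff.1 (neg_lt.1 h1)
    refine ⟨⟨by linarith, h3.1⟩, (hδT ?_).1⟩
    rw [Real.dist_eq, sub_zero, abs_lt]
    exact ⟨by linarith, h3.2⟩
  have hu : ∀ t ∈ Set.Ioo (-min ε δ) (min ε δ),
      HasDerivAt (fun t ↦ (β t).1) (β t).2 t := fun t ht ↦ by
    simpa [V] using! (hasFDerivAt_fst (p := β t)).comp_hasDerivAt t (hβ t (hsub t ht).1)
  have hw : ∀ t ∈ Set.Ioo (-min ε δ) (min ε δ),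
      HasDerivAt (fun t ↦ (β t).2) (G (β t)) t := fun t ht ↦ by
    simpa [V] using! (hasFDerivAt_snd (p := β t)).comp_hasDerivAt t (hβ t (hsub t ht).1)
  refine ⟨min ε δ, lt_min hε hδ, fun t ↦ (β t).1, fun t ↦ (β t).2, fun t ↦ G (β t),
    by simp [hβ0], by simp [hβ0], ?_, fun t ht ↦ ⟨(hsub t ht).2, hu t ht, hw t ht, ?_⟩⟩
  · have hβc : ContinuousOn β (Set.Ioo (-min ε δ) (min ε δ)) := fun t ht ↦
      (hβ t (hsub t ht).1).continuousAt.continuousWithinAt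
    -- Bootstrap: `w' = G(u, w)` is continuous, so `w` is `C^1`; then `u' = w` makes `u` of class
    -- `C^2`.
    have hw1 : ContDiffOn ℝ 1 (fun t ↦ (β t).2) (Set.Ioo (-min ε δ) (min ε δ)) := by
      rw [show (1 : ℕ∞ω) = 0 + 1 by simp, contDiffOn_succ_iff_deriv_of_isOpen isOpen_Ioo]
      refine ⟨fun t ht ↦ (hw t ht).differentiableAt.differentiableWithinAt, by simp, ?_⟩
      rw [contDiffOn_zero]
      exact (hG.continuousOn.comp hβc fun t ht ↦ ⟨(hsub t ht).2, trivial⟩).congr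
        fun t ht ↦ (hw t ht).deriv
    rw [show (2 : ℕ∞ω) = 1 + 1 by norm_num, contDiffOn_succ_iff_deriv_of_isOpen isOpen_Ioo]
    exact ⟨fun t ht ↦ (hu t ht).differentiableAt.differentiableWithinAt, by simp,
      hw1.congr fun t ht ↦ (hu t ht).deriv⟩
  · obtain ⟨e, he⟩ := hinv _ (hsub t ht).2
    simp only [G, map_neg, ← he, ContinuousLinearMap.inverse_equiv]
    simp

end LocalCalculus

/-! ### Covariant and Lie derivatives in coordinates. -/

section LocalIdentities

theorem hasDerivAt_along_curve {E G : Type*} [NormedAddCommGroup E] [NormedSpace ℝ E]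
    [NormedAddCommGroup G] [NormedSpace ℝ G] {l : E → G} {c : ℝ → E} {c' x : E} {t : ℝ}
    (hl : DifferentiableAt ℝ l x) (hc : HasDerivAt c c' t) (hx : c t = x) :
    HasDerivAt (fun s ↦ l (c s)) (fderiv ℝ l x c') t := by
  subst hx
  exact hl.hasFDerivAt.comp_hasDerivAt t hc

variable {E : Type*} [NormedAddCommGroup E] [NormedSpace ℝ E]
  {g : E → E →L[ℝ] E →L[ℝ] ℝ}

theorem fderiv_symm_of_eventually_symm {x : E} (hg : DifferentiableAt ℝ g x)
    (hsymm : ∀ᶠ y in nhds x, ∀ a b, g y a b = g y b a) (v a b : E) :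
    fderiv ℝ g x v a b = fderiv ℝ g x v b a := by
  have h : ∀ a b, HasFDerivAt (fun y ↦ g y a b) (((fderiv ℝ g x).flip a).flip b) x := fun a b ↦ by
    simpa using! (hg.hasFDerivAt.clm_apply (hasFDerivAt_const a x)).clm_apply
      (hasFDerivAt_const b x)
  have h2 : HasFDerivAt (fun y ↦ g y a b) (((fderiv ℝ g x).flip b).flip a) x :=
    (h b a).congr_of_eventuallyEq (hsymm.mono fun y hy ↦ hy a b)
  simpa using congrArg (fun l : E →L[ℝ] ℝ ↦ l v) ((h a b).unique h2)

/-- `Γ (v, Y; v) = (∂_Y g)(v, v) / 2`. -/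
theorem christoffelForm_apply_first {x : E} (hg : DifferentiableAt ℝ g x)
    (hsymm : ∀ᶠ y in nhds x, ∀ a b, g y a b = g y b a) (v y : E) :
    christoffelForm g x v y v = fderiv ℝ g x y v v / 2 := by
  rw [christoffelForm_apply, fderiv_symm_of_eventually_symm hg hsymm v y v]
  ring

/-- A vector field of constant length is orthogonal to its covariant derivatives. -/
theorem covariant_orthogonal_of_unit {X : E → E} {x : E} (hg : DifferentiableAt ℝ g x)
    (hsymm : ∀ᶠ y in nhds x, ∀ a b, g y a b = g y b a) (hX : DifferentiableAt ℝ X x)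
    (hunit : ∀ᶠ y in nhds x, g y (X y) (X y) = 1) (v : E) :
    g x (fderiv ℝ X x v) (X x) + christoffelForm g x v (X x) (X x) = 0 := by
  have h1 := (hg.hasFDerivAt.clm_apply hX.hasFDerivAt).clm_apply hX.hasFDerivAt
  have h2 : HasFDerivAt (fun y ↦ g y (X y) (X y)) (0 : E →L[ℝ] ℝ) x :=
    (hasFDerivAt_const (1 : ℝ) x).congr_of_eventuallyEq hunit
  have h3 := congrArg (fun l : E →L[ℝ] ℝ ↦ l v) (h1.unique h2)
  have h4 := hsymm.self_of_nhds (X x) (fderiv ℝ X x v)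
  simp at h3
  -- In `Γ(v, X; X)` the two derivatives in the direction `X` cancel, leaving `(∂_v g)(X, X) / 2`.
  rw [christoffelForm_apply]
  linarith

variable {u w : ℝ → E} {a : E} {t : ℝ}

set_option maxSynthPendingDepth 3 in
/-- Geodesics have constant speed. -/
theorem hasDerivAt_speed_sq (hg : DifferentiableAt ℝ g (u t))
    (hsymm : ∀ᶠ y in nhds (u t), ∀ a b, g y a b = g y b a)
    (hu : HasDerivAt u (w t) t) (hw : HasDerivAt w a t)
    (hgeo : g (u t) a + christoffelForm g (u t) (w t) (w t) = 0) :
    HasDerivAt (fun s ↦ g (u s) (w s) (w s)) 0 t := by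
  have h := hasDerivAt_bilinear (hasDerivAt_along_curve hg hu rfl) hw hw
  have h1 := congrArg (fun l : E →L[ℝ] ℝ ↦ l (w t)) hgeo
  have h2 := hsymm.self_of_nhds a (w t)
  simp [christoffelForm_apply] at h1
  convert! h using 1
  linarith

set_option maxSynthPendingDepth 3 in
/-- Along a geodesic, the derivative of the product of the velocity with a vector field `X` is
the product of the velocity with the covariant derivative of `X`. -/
theorem hasDerivAt_inner_field {X : E → E} (hg : DifferentiableAt ℝ g (u t))
    (hsymm : ∀ᶠ y in nhds (u t), ∀ a b, g y a b = g y b a)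
    (hX : DifferentiableAt ℝ X (u t))
    (hu : HasDerivAt u (w t) t) (hw : HasDerivAt w a t)
    (hgeo : g (u t) a + christoffelForm g (u t) (w t) (w t) = 0) :
    HasDerivAt (fun s ↦ g (u s) (X (u s)) (w s))
      (g (u t) (fderiv ℝ X (u t) (w t)) (w t) +
        christoffelForm g (u t) (w t) (X (u t)) (w t)) t := by
  have h := hasDerivAt_bilinear (hasDerivAt_along_curve hg hu rfl)
    (hasDerivAt_along_curve hX hu rfl) hw
  have h1 := congrArg (fun l : E →L[ℝ] ℝ ↦ l (X (u t))) hgeo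
  have h2 := hsymm.self_of_nhds a (X (u t))
  have h3 := fderiv_symm_of_eventually_symm hg hsymm (w t) (w t) (X (u t))
  simp only [add_apply, christoffelForm_apply,
    zero_apply] at h1
  convert! h using 1
  simp only [christoffelForm_apply]
  linarith

variable {F : Type*} [NormedAddCommGroup F] [NormedSpace ℝ F]

set_option maxSynthPendingDepth 3 in
/-- If `X` is tangent to the fibres of `P`, and the pull-back under `P` of a metric is at most `g`,
with equality on `v`, then the Lie derivative of `g` along `X` vanishes on `v`. -/
theorem lieDeriv_eq_zero_of_touching {h : F → F →L[ℝ] F →L[ℝ] ℝ} {P : E → F} {X : E → E} {x : E}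
    (hg : DifferentiableAt ℝ g x) (hP : ContDiffAt ℝ 2 P x) (hh : DifferentiableAt ℝ h (P x))
    (hX : DifferentiableAt ℝ X x) (hvert : ∀ᶠ y in nhds x, fderiv ℝ P y (X y) = 0)
    (hle : ∀ᶠ y in nhds x, ∀ b, h (P y) (fderiv ℝ P y b) (fderiv ℝ P y b) ≤ g y b b)
    {v : E} (hv : h (P x) (fderiv ℝ P x v) (fderiv ℝ P x v) = g x v v) :
    fderiv ℝ g x (X x) v v + g x (fderiv ℝ X x v) v + g x v (fderiv ℝ X x v) = 0 := by
  have hDP : DifferentiableAt ℝ (fderiv ℝ P) x :=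
    (hP.fderiv_right (m := 1) (by norm_num)).differentiableAt one_ne_zero
  have hP1 : DifferentiableAt ℝ P x := hP.differentiableAt (by norm_num)
  -- Differentiate `dP(X) = 0` in the direction `v` and use the symmetry of `D²P`.
  have hflat : fderiv ℝ (fderiv ℝ P) x (X x) v + fderiv ℝ P x (fderiv ℝ X x v) = 0 := by
    have h1 := hDP.hasFDerivAt.clm_apply hX.hasFDerivAt
    have h2 : HasFDerivAt (fun y ↦ fderiv ℝ P y (X y)) (0 : E →L[ℝ] F) x :=
      (hasFDerivAt_const (0 : F) x).congr_of_eventuallyEq hvert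
    have h3 := congrArg (fun l : E →L[ℝ] F ↦ l v) (h1.unique h2)
    have h4 : fderiv ℝ (fderiv ℝ P) x (X x) v = fderiv ℝ (fderiv ℝ P) x v (X x) :=
      (hP.isSymmSndFDerivAt (by simp)).eq _ _
    rw [h4, add_comm]
    simpa using h3
  -- To first order, `(c, b)` is the image of `(x, v)` under the flow of `X`. By `hflat`, `dP` of
  -- this moving vector is stationary at `0`.
  let c : ℝ → E := fun s ↦ x + s • X x
  let b : ℝ → E := fun s ↦ v + s • fderiv ℝ X x v
  have hc0 : c 0 = x := by simp [c]
  have hb0 : b 0 = v := by simp [b]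
  have hc : HasDerivAt c (X x) 0 := by
    simpa [c] using ((hasDerivAt_id (0 : ℝ)).smul_const (X x)).const_add x
  have hb : HasDerivAt b (fderiv ℝ X x v) 0 := by
    simpa [b] using ((hasDerivAt_id (0 : ℝ)).smul_const (fderiv ℝ X x v)).const_add v
  have hPc : HasDerivAt (fun s ↦ P (c s)) 0 0 := by
    have := hasDerivAt_along_curve hP1 hc hc0
    rwa [hvert.self_of_nhds] at this
  have hDPc : HasDerivAt (fun s ↦ fderiv ℝ P (c s)) (fderiv ℝ (fderiv ℝ P) x (X x)) 0 :=
    hasDerivAt_along_curve hDP hc hc0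
  have hz : HasDerivAt (fun s ↦ fderiv ℝ P (c s) (b s)) 0 0 := by
    have := hDPc.clm_apply hb
    rwa [hc0, hb0, hflat] at this
  have hhc : HasDerivAt (fun s ↦ h (P (c s))) 0 0 := by
    simpa using hasDerivAt_along_curve hh hPc (congrArg P hc0)
  have hgc : HasDerivAt (fun s ↦ g (c s)) (fderiv ℝ g x (X x)) 0 :=
    hasDerivAt_along_curve hg hc hc0
  have hN : HasDerivAt (fun s ↦ h (P (c s)) (fderiv ℝ P (c s) (b s)) (fderiv ℝ P (c s) (b s)))
      0 0 := by
    simpa using (hhc.clm_apply hz).clm_apply hz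
  have hdiff := (hasDerivAt_bilinear hgc hb hb).sub hN
  -- The difference is nonnegative by `hle` and zero at `s = 0` by `hv`. As the pulled-back part is
  -- stationary, its derivative is the Lie derivative of `g` on `v`.
  have hmin : IsLocalMin (fun s ↦ g (c s) (b s) (b s) -
      h (P (c s)) (fderiv ℝ P (c s) (b s)) (fderiv ℝ P (c s) (b s))) 0 := by
    have htend : Filter.Tendsto c (nhds 0) (nhds x) := by
      simpa only [hc0] using hc.continuousAt.tendsto
    filter_upwards [htend.eventually hle] with s hs
    simp only [hc0, hb0, hv, sub_self]
    exact sub_nonneg.2 (hs _)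
  have := hmin.hasDerivAt_eq_zero hdiff
  simpa only [hc0, hb0, sub_zero] using this

end LocalIdentities

/-! ### Charts, vector fields and the metric in coordinates. -/

section Chart

variable {d : ℕ} {M : Type*} [TopologicalSpace M] [ChartedSpace (EuclideanSpace ℝ (Fin d)) M]

/-- The derivative of the chart around `c`, with values in the model space. -/
noncomputable def chartDeriv (c q : M) :
    TangentSpace (𝓡 d) q →L[ℝ] EuclideanSpace ℝ (Fin d) :=
  mfderiv (𝓡 d) (𝓡 d) (extChartAt (𝓡 d) c) q

/-- The derivative of the inverse of the chart around `c`, defined on the model space. -/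
noncomputable def chartInvDeriv (c : M) (x : EuclideanSpace ℝ (Fin d)) :
    EuclideanSpace ℝ (Fin d) →L[ℝ] TangentSpace (𝓡 d) ((extChartAt (𝓡 d) c).symm x) :=
  mfderiv (𝓡 d) (𝓡 d) (extChartAt (𝓡 d) c).symm x

/-- The chart reading of a vector field. -/
noncomputable def fieldInChart (c : M) (Y : ∀ p : M, TangentSpace (𝓡 d) p)
    (x : EuclideanSpace ℝ (Fin d)) : EuclideanSpace ℝ (Fin d) :=
  chartDeriv c ((extChartAt (𝓡 d) c).symm x)
    (Y ((extChartAt (𝓡 d) c).symm x))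

section Metric

variable [RiemannianBundle (fun p : M ↦ TangentSpace (𝓡 d) p)]

theorem metricInChart_apply (c : M) (x a b : EuclideanSpace ℝ (Fin d)) :
    metricInChart c x a b =
      inner ℝ (E := TangentSpace (𝓡 d) ((extChartAt (𝓡 d) c).symm x))
        (chartInvDeriv c x a)
        (chartInvDeriv c x b) :=
  rfl

theorem metricInChart_symm (c : M) (x a b : EuclideanSpace ℝ (Fin d)) :
    metricInChart c x a b = metricInChart c x b a := by
  rw [metricInChart_apply, metricInChart_apply, real_inner_comm]

/-- Bridge from `covDeriv` to the coordinate identities for `christoffelForm`. -/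
theorem inner_covDeriv (Y : ∀ p : M, TangentSpace (𝓡 d) p) (p : M) (v w : TangentSpace (𝓡 d) p) :
    inner ℝ (covDeriv Y p v) w =
      metricInChart p (extChartAt (𝓡 d) p p)
        (fderiv ℝ (fieldInChart p Y) (extChartAt (𝓡 d) p p)
          (chartDeriv p p v))
        (chartDeriv p p w) +
      christoffelForm (metricInChart p) (extChartAt (𝓡 d) p p)
        (chartDeriv p p v)
        (fieldInChart p Y (extChartAt (𝓡 d) p p))
        (chartDeriv p p w) := by
  rw [covDeriv, InnerProductSpace.toDual_symm_apply]
  rfl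

end Metric

variable [IsManifold (𝓡 d) ∞ M]

theorem mfderiv_extChartAt_mfderiv_symm (c : M) {x : EuclideanSpace ℝ (Fin d)}
    (hx : x ∈ (extChartAt (𝓡 d) c).target) (a : EuclideanSpace ℝ (Fin d)) :
    chartDeriv c ((extChartAt (𝓡 d) c).symm x)
      (chartInvDeriv c x a) = a := by
  have : IsManifold (𝓡 d) 1 M := IsManifold.of_le (n := ∞) (by norm_cast)
  have h := mfderiv_extChartAt_comp_mfderivWithin_extChartAt_symm (I := 𝓡 d) hx
  rw [ModelWithCorners.range_eq_univ, mfderivWithin_univ] at h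
  exact congrArg (fun l : EuclideanSpace ℝ (Fin d) →L[ℝ] EuclideanSpace ℝ (Fin d) ↦ l a) h

theorem mfderiv_symm_mfderiv_extChartAt (c : M) {x : EuclideanSpace ℝ (Fin d)}
    (hx : x ∈ (extChartAt (𝓡 d) c).target)
    (v : TangentSpace (𝓡 d) ((extChartAt (𝓡 d) c).symm x)) :
    chartInvDeriv c x
      (chartDeriv c ((extChartAt (𝓡 d) c).symm x) v) = v := by
  have : IsManifold (𝓡 d) 1 M := IsManifold.of_le (n := ∞) (by norm_cast)
  have h := mfderivWithin_extChartAt_symm_comp_mfderiv_extChartAt (I := 𝓡 d) hx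
  rw [ModelWithCorners.range_eq_univ, mfderivWithin_univ] at h
  exact congrArg (fun l : TangentSpace (𝓡 d) ((extChartAt (𝓡 d) c).symm x) →L[ℝ]
    TangentSpace (𝓡 d) ((extChartAt (𝓡 d) c).symm x) ↦ l v) h

theorem trivializationAt_tangent_snd (c : M) {q : M} (hq : q ∈ (extChartAt (𝓡 d) c).source)
    (v : TangentSpace (𝓡 d) q) :
    (trivializationAt (EuclideanSpace ℝ (Fin d)) (TangentSpace (𝓡 d)) c ⟨q, v⟩).2 =
      chartDeriv c q v := by
  have : IsManifold (𝓡 d) 1 M := IsManifold.of_le (n := ∞) (by norm_cast)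
  rw [extChartAt_source] at hq
  have h := congrArg (fun l : TangentSpace (𝓡 d) q →L[ℝ] EuclideanSpace ℝ (Fin d) ↦ l v)
    (TangentBundle.continuousLinearMapAt_trivializationAt (I := 𝓡 d) hq)
  exact (Bundle.Trivialization.continuousLinearMapAt_apply_of_mem (R := ℝ) _
    (by simpa using hq) v).symm.trans h

theorem mem_trivializationAt_tangent_source (c : M) {q : M}
    (hq : q ∈ (extChartAt (𝓡 d) c).source) (v : TangentSpace (𝓡 d) q) :
    (⟨q, v⟩ : TangentBundle (𝓡 d) M) ∈
      (trivializationAt (EuclideanSpace ℝ (Fin d)) (TangentSpace (𝓡 d)) c).source := by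
  rw [extChartAt_source] at hq
  rw [Bundle.Trivialization.mem_source]
  simpa using hq

theorem contMDiffOn_symm_target (c : M) :
    ContMDiffOn (𝓡 d) (𝓡 d) ∞ (extChartAt (𝓡 d) c).symm (extChartAt (𝓡 d) c).target :=
  contMDiffOn_extChartAt_symm c

/-- In the tangent trivialization at `c` this field is the constant `a`. Products of such fields are
the coefficients of the metric, which gives the smoothness of `metricInChart`. -/
theorem contMDiffOn_coordinate_field (c : M) (a : EuclideanSpace ℝ (Fin d)) :
    ContMDiffOn (𝓡 d) (𝓡 d).tangent ∞
      (fun x ↦ (⟨(extChartAt (𝓡 d) c).symm x,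
        chartInvDeriv c x a⟩ : TangentBundle (𝓡 d) M))
      (extChartAt (𝓡 d) c).target := by
  rw [Bundle.Trivialization.contMDiffOn_iff
    (e := trivializationAt (EuclideanSpace ℝ (Fin d)) (TangentSpace (𝓡 d)) c)]
  · refine ⟨contMDiffOn_symm_target c, (contMDiffOn_const (c := a)).congr fun x hx ↦ ?_⟩
    rw [trivializationAt_tangent_snd c ((extChartAt (𝓡 d) c).map_target hx)]
    exact mfderiv_extChartAt_mfderiv_symm c hx a
  · exact fun x hx ↦ mem_trivializationAt_tangent_source c ((extChartAt (𝓡 d) c).map_target hx) _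

theorem contDiffOn_fieldInChart (c : M) {Y : ∀ p : M, TangentSpace (𝓡 d) p}
    (hY : IsSmoothVectorField Y) :
    ContDiffOn ℝ ∞ (fieldInChart c Y) (extChartAt (𝓡 d) c).target := by
  have h := hY.comp_contMDiffOn (contMDiffOn_symm_target c)
  rw [Bundle.Trivialization.contMDiffOn_iff
    (e := trivializationAt (EuclideanSpace ℝ (Fin d)) (TangentSpace (𝓡 d)) c)] at h
  · rw [← contMDiffOn_iff_contDiffOn]
    exact h.2.congr fun x hx ↦
      (trivializationAt_tangent_snd c ((extChartAt (𝓡 d) c).map_target hx) _).symm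
  · exact fun x hx ↦ mem_trivializationAt_tangent_source c ((extChartAt (𝓡 d) c).map_target hx) _

theorem mfderiv_symm_fieldInChart (c : M) (Y : ∀ p : M, TangentSpace (𝓡 d) p)
    {x : EuclideanSpace ℝ (Fin d)} (hx : x ∈ (extChartAt (𝓡 d) c).target) :
    chartInvDeriv c x (fieldInChart c Y x) =
      Y ((extChartAt (𝓡 d) c).symm x) :=
  mfderiv_symm_mfderiv_extChartAt c hx _

variable [RiemannianBundle (fun p : M ↦ TangentSpace (𝓡 d) p)]

theorem eq_zero_of_metricInChart_eq_zero (c : M) {x : EuclideanSpace ℝ (Fin d)}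
    (hx : x ∈ (extChartAt (𝓡 d) c).target) {a : EuclideanSpace ℝ (Fin d)}
    (ha : metricInChart c x a = 0) : a = 0 := by
  have h : metricInChart c x a a = 0 := by rw [ha]; rfl
  rw [metricInChart_apply, inner_self_eq_zero] at h
  rw [← mfderiv_extChartAt_mfderiv_symm c hx a, h]
  exact map_zero _

variable [IsContMDiffRiemannianBundle (𝓡 d) ∞ (EuclideanSpace ℝ (Fin d))
      (fun p : M ↦ TangentSpace (𝓡 d) p)]

theorem contDiffOn_metricInChart (c : M) :
    ContDiffOn ℝ ∞ (metricInChart c) (extChartAt (𝓡 d) c).target := by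
  rw [contDiffOn_clm_apply]
  intro a
  rw [contDiffOn_clm_apply]
  intro b
  rw [← contMDiffOn_iff_contDiffOn]
  exact (contMDiffOn_coordinate_field c a).inner_bundle (contMDiffOn_coordinate_field c b)

theorem differentiableAt_metricInChart (c : M) {x : EuclideanSpace ℝ (Fin d)}
    (hx : x ∈ (extChartAt (𝓡 d) c).target) : DifferentiableAt ℝ (metricInChart c) x :=
  ((contDiffOn_metricInChart c).contDiffAt ((isOpen_extChartAt_target c).mem_nhds hx)
    ).differentiableAt (by simp)

end Chart

set_option maxSynthPendingDepth 3 in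
theorem christoffelForm_zero_right {E : Type*} [NormedAddCommGroup E] [NormedSpace ℝ E]
    (g : E → E →L[ℝ] E →L[ℝ] ℝ) (x a : E) : christoffelForm g x a 0 = 0 := by
  ext e
  simp [christoffelForm_apply]

/-! ### Passing between a point and its chart image. -/

section ChartTransport

variable {d : ℕ} {M : Type*} [TopologicalSpace M] [ChartedSpace (EuclideanSpace ℝ (Fin d)) M]

theorem fieldInChart_apply_chart (c : M) {q : M} (hq : q ∈ (extChartAt (𝓡 d) c).source)
    (Y : ∀ p : M, TangentSpace (𝓡 d) p) :
    fieldInChart c Y (extChartAt (𝓡 d) c q) =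
      chartDeriv c q (Y q) := by
  have h := (extChartAt (𝓡 d) c).left_inv hq
  exact congrArg (fun r ↦ (chartDeriv c r (Y r) :
    EuclideanSpace ℝ (Fin d))) h

variable [RiemannianBundle (fun p : M ↦ TangentSpace (𝓡 d) p)] in
theorem covDeriv_zero (p : M) (v : TangentSpace (𝓡 d) p) :
    covDeriv (fun q : M ↦ (0 : TangentSpace (𝓡 d) q)) p v = 0 := by
  refine ext_inner_right ℝ fun w ↦ ?_
  have h : fieldInChart p (fun q : M ↦ (0 : TangentSpace (𝓡 d) q)) = fun _ ↦ 0 :=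
    funext fun x ↦ map_zero _
  rw [inner_covDeriv, h, inner_zero_left, fderiv_fun_const, christoffelForm_zero_right]
  simp

variable [IsManifold (𝓡 d) ∞ M]

/-- Functions on the tangent bundle do not see the passage to a chart and back. -/
theorem apply_symm_mfderiv_symm {β : Type*} (c : M) {q : M}
    (hq : q ∈ (extChartAt (𝓡 d) c).source) (Φ : ∀ q : M, TangentSpace (𝓡 d) q → β)
    (v : TangentSpace (𝓡 d) q) :
    Φ ((extChartAt (𝓡 d) c).symm (extChartAt (𝓡 d) c q))
      (chartInvDeriv c (extChartAt (𝓡 d) c q)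
        (chartDeriv c q v)) = Φ q v := by
  obtain ⟨x, hx, rfl⟩ : ∃ x ∈ (extChartAt (𝓡 d) c).target, (extChartAt (𝓡 d) c).symm x = q :=
    ⟨_, (extChartAt (𝓡 d) c).map_source hq, (extChartAt (𝓡 d) c).left_inv hq⟩
  -- The tangent space depends on the base point, so the point is generalized first and the equality
  -- eliminated by substitution.
  have h : ∀ y, y = x → Φ ((extChartAt (𝓡 d) c).symm y)
      (chartInvDeriv c y
        (chartDeriv c ((extChartAt (𝓡 d) c).symm x) v)) =
      Φ ((extChartAt (𝓡 d) c).symm x) v := by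
    rintro y rfl
    rw [mfderiv_symm_mfderiv_extChartAt c hx]
  exact h _ ((extChartAt (𝓡 d) c).right_inv hx)

theorem mdifferentiableAt_symm (c : M) {x : EuclideanSpace ℝ (Fin d)}
    (hx : x ∈ (extChartAt (𝓡 d) c).target) :
    MDifferentiableAt (𝓡 d) (𝓡 d) (extChartAt (𝓡 d) c).symm x :=
  ((contMDiffOn_symm_target c).contMDiffAt
    ((isOpen_extChartAt_target c).mem_nhds hx)).mdifferentiableAt (by simp)

theorem differentiableAt_fieldInChart (c : M) {Y : ∀ p : M, TangentSpace (𝓡 d) p}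
    (hY : IsSmoothVectorField Y) {x : EuclideanSpace ℝ (Fin d)}
    (hx : x ∈ (extChartAt (𝓡 d) c).target) : DifferentiableAt ℝ (fieldInChart c Y) x :=
  ((contDiffOn_fieldInChart c hY).contDiffAt ((isOpen_extChartAt_target c).mem_nhds hx)
    ).differentiableAt (by simp)

variable [RiemannianBundle (fun p : M ↦ TangentSpace (𝓡 d) p)]

theorem metricInChart_mfderiv (c : M) {q : M} (hq : q ∈ (extChartAt (𝓡 d) c).source)
    (v w : TangentSpace (𝓡 d) q) :
    metricInChart c (extChartAt (𝓡 d) c q) (chartDeriv c q v)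
      (chartDeriv c q w) = inner ℝ v w := by
  obtain ⟨x, hx, rfl⟩ : ∃ x ∈ (extChartAt (𝓡 d) c).target, (extChartAt (𝓡 d) c).symm x = q :=
    ⟨_, (extChartAt (𝓡 d) c).map_source hq, (extChartAt (𝓡 d) c).left_inv hq⟩
  rw [(extChartAt (𝓡 d) c).right_inv hx, metricInChart_apply,
    mfderiv_symm_mfderiv_extChartAt c hx, mfderiv_symm_mfderiv_extChartAt c hx]

end ChartTransport

/-! ### Geodesics on the manifold. -/

section Geodesics

variable {d : ℕ} {M : Type*} [TopologicalSpace M] [ChartedSpace (EuclideanSpace ℝ (Fin d)) M]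
  [IsManifold (𝓡 d) ∞ M]

theorem velocity_symm_comp (c : M) {u : ℝ → EuclideanSpace ℝ (Fin d)}
    {w : EuclideanSpace ℝ (Fin d)} {t : ℝ} (hut : u t ∈ (extChartAt (𝓡 d) c).target)
    (hu : HasDerivAt u w t) :
    velocity (d := d) (fun s ↦ (extChartAt (𝓡 d) c).symm (u s)) t =
      chartInvDeriv c (u t) w := by
  have h := mfderiv_comp_apply (I := 𝓘(ℝ, ℝ)) (I' := 𝓡 d) (I'' := 𝓡 d) t
    (mdifferentiableAt_symm c hut) hu.differentiableAt.mdifferentiableAt (1 : ℝ)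
  have h1 : mfderiv 𝓘(ℝ, ℝ) (𝓡 d) u t (1 : ℝ) = w := by
    rw [mfderiv_eq_fderiv]
    exact hu.hasFDerivAt.fderiv ▸ one_smul ℝ w
  rw [h1] at h
  exact h

variable [RiemannianBundle (fun p : M ↦ TangentSpace (𝓡 d) p)]
  [IsContMDiffRiemannianBundle (𝓡 d) ∞ (EuclideanSpace ℝ (Fin d))
      (fun p : M ↦ TangentSpace (𝓡 d) p)]

/-- Local existence of geodesics, in a chart. -/
theorem exists_isGeodesicOn (c : M) {x : EuclideanSpace ℝ (Fin d)}
    (hx : x ∈ (extChartAt (𝓡 d) c).target) (v : EuclideanSpace ℝ (Fin d)) :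
    ∃ ε > 0, ∃ u w a : ℝ → EuclideanSpace ℝ (Fin d), u 0 = x ∧ w 0 = v ∧
      IsGeodesicOn (d := d) (fun t ↦ (extChartAt (𝓡 d) c).symm (u t)) (Set.Ioo (-ε) ε) ∧
      ∀ t ∈ Set.Ioo (-ε) ε, u t ∈ (extChartAt (𝓡 d) c).target ∧ HasDerivAt u (w t) t ∧
        HasDerivAt w (a t) t ∧
        metricInChart c (u t) (a t) + christoffelForm (metricInChart c) (u t) (w t) (w t) = 0 := by
  obtain ⟨ε, hε, u, w, a, hu0, hw0, hu2, H⟩ := exists_geodesic_local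
    (isOpen_extChartAt_target (I := 𝓡 d) c) (contDiffOn_metricInChart c)
    (fun x hx _ ↦ eq_zero_of_metricInChart_eq_zero c hx) hx v
  refine ⟨ε, hε, u, w, a, hu0, hw0, ⟨?_, fun t ht ↦ ⟨c, ?_, ?_⟩⟩, H⟩
  · exact ((contMDiffOn_symm_target c).of_le (by norm_cast)).comp
      (contMDiffOn_iff_contDiffOn.2 hu2) fun t ht ↦ (H t ht).1
  · exact (extChartAt (𝓡 d) c).map_target (H t ht).1
  · have h0 : ∀ s ∈ Set.Ioo (-ε) ε,
        extChartAt (𝓡 d) c ((extChartAt (𝓡 d) c).symm (u s)) = u s :=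
      fun s hs ↦ (extChartAt (𝓡 d) c).right_inv (H s hs).1
    have h1 : ∀ s ∈ Set.Ioo (-ε) ε,
        deriv (fun τ ↦ extChartAt (𝓡 d) c ((extChartAt (𝓡 d) c).symm (u τ))) s = w s :=
      fun s hs ↦ ((H s hs).2.1.congr_of_eventuallyEq
        (Filter.eventuallyEq_of_mem (isOpen_Ioo.mem_nhds hs) h0)).deriv
    have h2 : deriv (deriv
        (fun τ ↦ extChartAt (𝓡 d) c ((extChartAt (𝓡 d) c).symm (u τ)))) t = a t :=
      ((H t ht).2.2.1.congr_of_eventuallyEq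
        (Filter.eventuallyEq_of_mem (isOpen_Ioo.mem_nhds ht) h1)).deriv
    simp only [h2, h1 t ht, h0 t ht]
    exact (H t ht).2.2.2

end Geodesics

/-! ### The angle with a subspace. -/

section Angle

variable {V : Type*} [NormedAddCommGroup V] [InnerProductSpace ℝ V]

/-- From `⟨v, w⟩ = |w|²` for the projection `w` one gets `cos θ · |v| = |w|`. Multiplying by `‖v‖ ^
2` instead of dividing also covers `v = 0`. -/
theorem sin_angle_starProjection_sq_mul (K : Submodule ℝ V) [K.HasOrthogonalProjection] (v : V) :
    Real.sin (InnerProductGeometry.angle v (K.starProjection v)) ^ 2 * ‖v‖ ^ 2 =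
      ‖v‖ ^ 2 - ‖K.starProjection v‖ ^ 2 := by
  set w := K.starProjection v with hw
  have hin : inner ℝ v w = ‖w‖ ^ 2 := by
    have h := K.starProjection_inner_eq_zero v w (K.starProjection_apply_mem v)
    rw [← hw, inner_sub_left, real_inner_self_eq_norm_sq] at h
    linarith
  have h1 : Real.cos (InnerProductGeometry.angle v w) * (‖v‖ * ‖w‖) = ‖w‖ ^ 2 := by
    rw [InnerProductGeometry.cos_angle_mul_norm_mul_norm, hin]
  have h2 : Real.cos (InnerProductGeometry.angle v w) * ‖v‖ = ‖w‖ := by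
    by_cases h0 : ‖w‖ = 0
    · rw [norm_eq_zero.1 h0]
      simp
    · exact mul_right_cancel₀ h0 (by linarith)
  rw [Real.sin_sq, ← h2]
  ring

end Angle

/-! ### The covariant derivative of the Reeb field. -/

namespace AlmostContactMetricStructure

variable {d : ℕ} {M : Type*} [TopologicalSpace M] [ChartedSpace (EuclideanSpace ℝ (Fin d)) M]
  [IsManifold (𝓡 d) ∞ M] [RiemannianBundle (fun p : M ↦ TangentSpace (𝓡 d) p)]
  (S : AlmostContactMetricStructure d M)

theorem eta_eq_inner (p : M) (v : TangentSpace (𝓡 d) p) : S.eta p v = inner ℝ (S.xi p) v := by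
  have h := S.inner_phi_phi p (S.xi p) v
  rw [S.phi_xi, inner_zero_left, S.eta_xi] at h
  linarith

theorem inner_xi_xi (p : M) : inner ℝ (S.xi p) (S.xi p) = (1 : ℝ) := by
  rw [← S.eta_eq_inner, S.eta_xi]

theorem norm_xi (p : M) : ‖S.xi p‖ = 1 := by
  rw [norm_eq_sqrt_real_inner, S.inner_xi_xi, Real.sqrt_one]

/-- Computing `φ³ v` as `φ²(φ v)` and as `φ(φ² v)` leaves `η(φ v) ξ = 0`. -/
theorem eta_phi (p : M) (v : TangentSpace (𝓡 d) p) : S.eta p (S.phi p v) = 0 := by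
  have h1 := S.phi_phi p (S.phi p v)
  have h2 : S.phi p (S.phi p (S.phi p v)) = -S.phi p v := by
    rw [S.phi_phi p v, map_add, map_neg, map_smul, S.phi_xi, smul_zero, add_zero]
  rw [h2, left_eq_add] at h1
  have h3 := congrArg (S.eta p) h1
  simpa [S.eta_xi] using h3

variable {S}

/-- On a Kenmotsu manifold, `∇_E ξ - E` is proportional to `ξ`. -/
theorem IsKenmotsu.covDeriv_xi_sub (hS : S.IsKenmotsu) (p : M) (e : TangentSpace (𝓡 d) p) :
    covDeriv S.xi p e - e = S.eta p (covDeriv S.xi p e - e) • S.xi p := by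
  have h := hS.nabla_phi S.xi S.smooth_xi p e
  simp only [S.phi_xi, covDeriv_zero, S.eta_xi, one_smul] at h
  rw [real_inner_comm, ← S.eta_eq_inner, S.eta_phi, zero_smul, zero_sub, zero_sub, neg_inj] at h
  have h1 : S.phi p (covDeriv S.xi p e - e) = 0 := by rw [map_sub, h, sub_self]
  have h2 := S.phi_phi p (covDeriv S.xi p e - e)
  rw [h1, map_zero, eq_comm, neg_add_eq_zero] at h2
  exact h2

variable [IsContMDiffRiemannianBundle (𝓡 d) ∞ (EuclideanSpace ℝ (Fin d))
      (fun p : M ↦ TangentSpace (𝓡 d) p)]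

theorem inner_covDeriv_xi_xi (p : M) (e : TangentSpace (𝓡 d) p) :
    inner ℝ (covDeriv S.xi p e) (S.xi p) = 0 := by
  have hp := mem_extChartAt_source (I := 𝓡 d) p
  have hx := (extChartAt (𝓡 d) p).map_source hp
  rw [inner_covDeriv]
  rw [← fieldInChart_apply_chart p hp S.xi]
  refine covariant_orthogonal_of_unit (differentiableAt_metricInChart p hx)
    (Filter.Eventually.of_forall fun y ↦ metricInChart_symm p y)
    (differentiableAt_fieldInChart p S.smooth_xi hx) ?_ _
  filter_upwards [(isOpen_extChartAt_target p).mem_nhds hx] with y hy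
  rw [metricInChart_apply, mfderiv_symm_fieldInChart p S.xi hy, S.inner_xi_xi]

/-- On a Kenmotsu manifold, `g(∇_E ξ, E) = g(E, E) - η(E)²`. -/
theorem IsKenmotsu.inner_covDeriv_xi (hS : S.IsKenmotsu) (p : M) (e : TangentSpace (𝓡 d) p) :
    inner ℝ (covDeriv S.xi p e) e = ‖e‖ ^ 2 - S.eta p e ^ 2 := by
  have h := congrArg (fun z ↦ inner ℝ z e) (hS.covDeriv_xi_sub p e)
  simp only [inner_sub_left, real_inner_smul_left, map_sub, real_inner_self_eq_norm_sq] at h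
  rw [← S.eta_eq_inner, S.eta_eq_inner p (covDeriv S.xi p e),
    real_inner_comm (covDeriv S.xi p e) (S.xi p), inner_covDeriv_xi_xi] at h
  linarith

end AlmostContactMetricStructure

/-! ### Vertical and horizontal vectors of a submersion. -/

section Submersion

variable {d n : ℕ}
  {M : Type*} [TopologicalSpace M] [ChartedSpace (EuclideanSpace ℝ (Fin d)) M]
  {N : Type*} [TopologicalSpace N] [ChartedSpace (EuclideanSpace ℝ (Fin n)) N]

theorem exists_vertical_ne_zero (pr : M → N) (hdim : n < d) (p : M) :
    ∃ v ∈ vertical (d := d) (n := n) pr p, v ≠ 0 := by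
  refine (Submodule.ne_bot_iff _).1 (LinearMap.ker_ne_bot_of_finrank_lt ?_)
  have h1 : Module.finrank ℝ (TangentSpace (𝓡 d) p) = d := finrank_euclideanSpace_fin (𝕜 := ℝ)
  have h2 : Module.finrank ℝ (TangentSpace (𝓡 n) (pr p)) = n :=
    finrank_euclideanSpace_fin (𝕜 := ℝ)
  rwa [h1, h2]

variable [RiemannianBundle (fun p : M ↦ TangentSpace (𝓡 d) p)]

variable [RiemannianBundle (fun q : N ↦ TangentSpace (𝓡 n) q)] {pr : M → N}

theorem IsRiemannianSubmersion.norm_mfderiv_of_horizontal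
    (hpr : IsRiemannianSubmersion (d := d) (n := n) pr) (p : M) {v : TangentSpace (𝓡 d) p}
    (hv : v ∈ horizontal (d := d) (n := n) pr p) :
    ‖mfderiv (𝓡 d) (𝓡 n) pr p v‖ = ‖v‖ := by
  have h := hpr.inner_eq p v hv v hv
  rw [real_inner_self_eq_norm_sq, real_inner_self_eq_norm_sq] at h
  exact (sq_eq_sq₀ (norm_nonneg _) (norm_nonneg _)).1 h

/-- The differential kills the vertical part of `v` and is isometric on the horizontal part. -/
theorem IsRiemannianSubmersion.norm_mfderiv_le
    (hpr : IsRiemannianSubmersion (d := d) (n := n) pr) (p : M) (v : TangentSpace (𝓡 d) p) :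
    ‖mfderiv (𝓡 d) (𝓡 n) pr p v‖ ≤ ‖v‖ := by
  set w := (horizontal (d := d) (n := n) pr p).starProjection v
  have hw : w ∈ horizontal (d := d) (n := n) pr p := Submodule.starProjection_apply_mem _ _
  have h1 : v - w ∈ vertical (d := d) (n := n) pr p := by
    have := (horizontal (d := d) (n := n) pr p).sub_starProjection_mem_orthogonal v
    rwa [horizontal, Submodule.orthogonal_orthogonal] at this
  have h2 : mfderiv (𝓡 d) (𝓡 n) pr p v = mfderiv (𝓡 d) (𝓡 n) pr p w := by
    rw [← sub_eq_zero, ← map_sub]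
    exact h1
  rw [h2, hpr.norm_mfderiv_of_horizontal p hw]
  exact Submodule.norm_starProjection_apply_le _ _

end Submersion

/-! ### Horizontal `ξ`: the Clairaut relation along geodesics. -/

section Reeb

variable {d n : ℕ}
  {M : Type*} [TopologicalSpace M] [ChartedSpace (EuclideanSpace ℝ (Fin d)) M]
  [RiemannianBundle (fun p : M ↦ TangentSpace (𝓡 d) p)]
  {N : Type*} [TopologicalSpace N] [ChartedSpace (EuclideanSpace ℝ (Fin n)) N]

variable [IsManifold (𝓡 d) ∞ M]

/-- If every vector were vertical, anti-invariance would force `φ = 0`; then `φ² = -I + η ⊗ ξ` makes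
`ξ` span the tangent space. -/
theorem exists_horizontal_ne_zero {S : AlmostContactMetricStructure d M} {pr : M → N}
    (hanti : IsAntiInvariant (n := n) S pr) (hdim : 2 ≤ d) (p : M) :
    ∃ v ∈ horizontal (d := d) (n := n) pr p, v ≠ 0 := by
  by_contra! hcon
  have hbot : horizontal (d := d) (n := n) pr p = ⊥ := (Submodule.eq_bot_iff _).2 hcon
  have htop : vertical (d := d) (n := n) pr p = ⊤ := Submodule.orthogonal_eq_bot_iff.1 hbot
  have hphi : ∀ v, S.phi p v = 0 := fun v ↦ hcon _ (hanti p v (htop ▸ Submodule.mem_top))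
  have hspan : ∀ v, v = S.eta p v • S.xi p := fun v ↦ by
    have h := S.phi_phi p v
    rw [hphi, eq_comm, neg_add_eq_zero] at h
    exact h
  have h1 : Module.finrank ℝ (TangentSpace (𝓡 d) p) ≤ 1 :=
    finrank_le_one (S.xi p) fun v ↦ ⟨S.eta p v, (hspan v).symm⟩
  have h2 : Module.finrank ℝ (TangentSpace (𝓡 d) p) = d := finrank_euclideanSpace_fin (𝕜 := ℝ)
  omega

/-- The horizontal part of a vector is at least as long as its component along a horizontal `ξ`. -/
theorem eta_sq_le_norm_horizontal_sq {S : AlmostContactMetricStructure d M} {pr : M → N}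
    (hReeb : HasHorizontalReeb (n := n) S pr) (p : M) (v : TangentSpace (𝓡 d) p) :
    S.eta p v ^ 2 ≤ ‖(horizontal (d := d) (n := n) pr p).starProjection v‖ ^ 2 := by
  set w := (horizontal (d := d) (n := n) pr p).starProjection v with hw
  have h1 : S.eta p v = inner ℝ (S.xi p) w := by
    have h := (horizontal (d := d) (n := n) pr p).starProjection_inner_eq_zero v _ (hReeb p)
    rw [← hw, inner_sub_left, real_inner_comm, real_inner_comm _ w] at h
    rw [S.eta_eq_inner]
    linarith
  have h2 := abs_real_inner_le_norm (S.xi p) w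
  rw [S.norm_xi, one_mul] at h2
  rw [h1]
  exact sq_le_sq' (abs_le.1 h2).1 (abs_le.1 h2).2

variable [IsContMDiffRiemannianBundle (𝓡 d) ∞ (EuclideanSpace ℝ (Fin d))
      (fun p : M ↦ TangentSpace (𝓡 d) p)]

/-- If `ξ` is horizontal and `v` is vertical, then `df (v + b ξ) = b`, by the Clairaut relation
along the geodesic with initial velocity `v + b ξ`. -/
theorem mvfderiv_vertical_add_smul_xi {S : AlmostContactMetricStructure d M} (hS : S.IsKenmotsu)
    {pr : M → N} (hReeb : HasHorizontalReeb (n := n) S pr) {f : M → ℝ}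
    (hf : MDifferentiable (𝓡 d) 𝓘(ℝ, ℝ) f)
    (hcl : IsClairautWith (d := d) (n := n) pr (fun p ↦ Real.exp (f p)))
    {p : M} {v : TangentSpace (𝓡 d) p} (hv : v ∈ vertical (d := d) (n := n) pr p) (hv0 : v ≠ 0)
    (b : ℝ) : mvfderiv (𝓡 d) f p (v + b • S.xi p) = b := by
  have hp := mem_extChartAt_source (I := 𝓡 d) p
  have hx := (extChartAt (𝓡 d) p).map_source hp
  obtain ⟨ε, hε, u, w, a, hu0, hw0, hgeo, H⟩ :=
    exists_isGeodesicOn p hx (chartDeriv p p (v + b • S.xi p))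
  obtain ⟨C, hC⟩ := hcl.const _ _ isOpen_Ioo Set.ordConnected_Ioo hgeo
  have h0 : (0 : ℝ) ∈ Set.Ioo (-ε) ε := ⟨by linarith, hε⟩
  set α : ℝ → M := fun t ↦ (extChartAt (𝓡 d) p).symm (u t)
  set Q : ℝ → ℝ := fun t ↦ metricInChart p (u t) (w t) (w t)
  set y : ℝ → ℝ := fun t ↦ metricInChart p (u t) (fieldInChart p S.xi (u t)) (w t)
  have hvel : ∀ t ∈ Set.Ioo (-ε) ε, velocity (d := d) α t = chartInvDeriv p (u t) (w t) :=
    fun t ht ↦ velocity_symm_comp p (H t ht).1 (H t ht).2.1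
  have hQn : ∀ t ∈ Set.Ioo (-ε) ε, Q t = ‖velocity (d := d) α t‖ ^ 2 := fun t ht ↦ by
    rw [hvel t ht, ← real_inner_self_eq_norm_sq]
    rfl
  have hyn : ∀ t ∈ Set.Ioo (-ε) ε, y t = S.eta (α t) (velocity (d := d) α t) := fun t ht ↦ by
    rw [hvel t ht, S.eta_eq_inner, ← mfderiv_symm_fieldInChart p S.xi (H t ht).1]
    rfl
  -- values at the initial point
  have hstart : ∀ {β : Type} (Φ : ∀ q : M, TangentSpace (𝓡 d) q → β),
      Φ (α 0) (velocity (d := d) α 0) = Φ p (v + b • S.xi p) := fun Φ ↦ by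
    have h : ∀ x, x = extChartAt (𝓡 d) p p → Φ ((extChartAt (𝓡 d) p).symm x)
        (chartInvDeriv p x (chartDeriv p p (v + b • S.xi p))) = Φ p (v + b • S.xi p) := by
      rintro x rfl
      exact apply_symm_mfderiv_symm p hp Φ _
    rw [hvel 0 h0, hw0]
    exact h (u 0) hu0
  have hvxi : inner ℝ (S.xi p) v = 0 := by
    rw [real_inner_comm]
    exact hReeb p v hv
  have hy0 : y 0 = b := by
    rw [hyn 0 h0, hstart fun q z ↦ S.eta q z, map_add, map_smul, S.eta_xi, S.eta_eq_inner, hvxi]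
    simp
  have hQ0 : Q 0 = ‖v‖ ^ 2 + b ^ 2 := by
    rw [hQn 0 h0, hstart fun q z ↦ ‖z‖ ^ 2, norm_add_sq_real, real_inner_smul_right,
      real_inner_comm, hvxi, norm_smul, S.norm_xi, Real.norm_eq_abs, mul_one, sq_abs]
    ring
  have hproj0 : ‖(horizontal (d := d) (n := n) pr (α 0)).starProjection
      (velocity (d := d) α 0)‖ ^ 2 = b ^ 2 := by
    rw [hstart fun q z ↦ ‖(horizontal (d := d) (n := n) pr q).starProjection z‖ ^ 2, map_add,
      map_smul, Submodule.starProjection_eq_self_iff.2 (hReeb p),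
      (Submodule.starProjection_apply_eq_zero_iff _).2, zero_add, norm_smul, S.norm_xi,
      Real.norm_eq_abs, mul_one, sq_abs]
    exact Submodule.le_orthogonal_orthogonal _ hv
  -- derivatives at the initial time
  have hdf : HasDerivAt (fun t ↦ f (α t)) (mvfderiv (𝓡 d) f p (v + b • S.xi p)) 0 := by
    have hαd : MDifferentiableAt 𝓘(ℝ, ℝ) (𝓡 d) α 0 :=
      (mdifferentiableAt_symm p (H 0 h0).1).comp (0 : ℝ)
        (H 0 h0).2.1.differentiableAt.mdifferentiableAt
    have h1 : DifferentiableAt ℝ (f ∘ α) 0 :=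
      ((hf (α 0)).comp (0 : ℝ) hαd).differentiableAt
    have h2 := mfderiv_comp_apply (I := 𝓘(ℝ, ℝ)) (I' := 𝓡 d) (I'' := 𝓘(ℝ, ℝ)) (0 : ℝ)
      (hf (α 0)) hαd (1 : ℝ)
    rw [mfderiv_eq_fderiv] at h2
    rw [← hstart fun q z ↦ mvfderiv (𝓡 d) f q z]
    have h3 := h1.hasDerivAt
    rw [← fderiv_apply_one_eq_deriv] at h3
    exact h3.congr_deriv h2
  have hdiff := differentiableAt_metricInChart p (H 0 h0).1
  have hsymm := Filter.Eventually.of_forall (f := nhds (u 0)) fun z ↦ metricInChart_symm p z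
  have hdQ : HasDerivAt Q 0 0 :=
    hasDerivAt_speed_sq hdiff hsymm (H 0 h0).2.1 (H 0 h0).2.2.1 (H 0 h0).2.2.2
  have hdy : HasDerivAt y (‖v‖ ^ 2) 0 := by
    have h1 := hasDerivAt_inner_field hdiff hsymm
      (differentiableAt_fieldInChart p S.smooth_xi (H 0 h0).1)
      (H 0 h0).2.1 (H 0 h0).2.2.1 (H 0 h0).2.2.2
    have h2 := hS.inner_covDeriv_xi p (v + b • S.xi p)
    have h3 : ‖v + b • S.xi p‖ ^ 2 - S.eta p (v + b • S.xi p) ^ 2 = ‖v‖ ^ 2 := by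
      have e1 : ‖v + b • S.xi p‖ ^ 2 = Q 0 := by rw [hQn 0 h0, hstart fun q z ↦ ‖z‖ ^ 2]
      have e2 : S.eta p (v + b • S.xi p) = y 0 := by rw [hyn 0 h0, hstart fun q z ↦ S.eta q z]
      rw [e1, e2, hQ0, hy0]
      ring
    rw [h3, inner_covDeriv] at h2
    refine h1.congr_deriv ?_
    rw [hu0, hw0]
    exact h2
  -- the Clairaut relation
  have hrel : ∀ t ∈ Set.Ioo (-ε) ε, Real.exp (f (α t)) ^ 2 * (Q t -
      ‖(horizontal (d := d) (n := n) pr (α t)).starProjection (velocity (d := d) α t)‖ ^ 2) =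
      C ^ 2 * Q t := fun t ht ↦ by
    rw [hQn t ht, ← sin_angle_starProjection_sq_mul, ← hC t ht]
    simp only [horizontalAngle]
    ring
  have hL := ((hdf.exp.pow 2).mul (hdQ.sub (hdy.pow 2))).sub (hdQ.const_mul (C ^ 2))
  -- By `hrel` this function equals `e^{2f}(|hor α'|² - y²)`, which is nonnegative and vanishes at
  -- `0`, where the horizontal part of the velocity is `bξ`.
  have hmin : IsLocalMin (fun t ↦ Real.exp (f (α t)) ^ 2 * (Q t - y t ^ 2) - C ^ 2 * Q t) 0 := by
    filter_upwards [isOpen_Ioo.mem_nhds h0] with t ht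
    have e1 := hrel 0 h0
    rw [hproj0] at e1
    have e2 := eta_sq_le_norm_horizontal_sq hReeb (α t) (velocity (d := d) α t)
    rw [← hyn t ht] at e2
    rw [hy0, e1, sub_self, ← hrel t ht, ← mul_sub]
    exact mul_nonneg (sq_nonneg _) (by linarith)
  have hz := hmin.hasDerivAt_eq_zero hL
  simp only [Pi.pow_apply, Pi.sub_apply, hy0, hQ0] at hz
  have hvpos : 0 < ‖v‖ ^ 2 := pow_pos (norm_pos_iff.2 hv0) 2
  have hexp := Real.exp_pos (f (α 0))
  -- The vanishing derivative, with `Q 0 - y 0 ^ 2 = ‖v‖ ^ 2`, `Q' = 0` and `y' = ‖v‖ ^ 2`.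
  have hfac : (2 * Real.exp (f (α 0)) ^ 2 * ‖v‖ ^ 2) *
      (mvfderiv (𝓡 d) f p (v + b • S.xi p) - b) = 0 := by
    generalize mvfderiv (𝓡 d) f p (v + b • S.xi p) = l at hz ⊢
    norm_num at hz
    linear_combination hz
  rcases mul_eq_zero.1 hfac with h | h
  · exact absurd h (by positivity)
  · linarith

theorem inner_grad_xi_of_horizontal {S : AlmostContactMetricStructure d M} (hS : S.IsKenmotsu)
    (hdim : n < d) {pr : M → N} (hReeb : HasHorizontalReeb (n := n) S pr) {f : M → ℝ}
    (hf : MDifferentiable (𝓡 d) 𝓘(ℝ, ℝ) f)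
    (hcl : IsClairautWith (d := d) (n := n) pr (fun p ↦ Real.exp (f p))) (p : M) :
    inner ℝ (grad (d := d) f p) (S.xi p) = 1 := by
  obtain ⟨v, hv, hv0⟩ := exists_vertical_ne_zero (d := d) (n := n) pr hdim p
  have h0 := mvfderiv_vertical_add_smul_xi hS hReeb hf hcl hv hv0 0
  have h1 := mvfderiv_vertical_add_smul_xi hS hReeb hf hcl hv hv0 1
  rw [zero_smul, add_zero] at h0
  rw [one_smul, map_add, h0, zero_add] at h1
  rw [grad, InnerProductSpace.toDual_symm_apply, h1]

end Reeb

/-! ### Vertical `ξ`: excluded by the submersion geometry. -/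

section VerticalReeb

variable {d n : ℕ}
  {M : Type*} [TopologicalSpace M] [ChartedSpace (EuclideanSpace ℝ (Fin d)) M]
  [IsManifold (𝓡 d) ∞ M]
  {N : Type*} [TopologicalSpace N] [ChartedSpace (EuclideanSpace ℝ (Fin n)) N]
  [IsManifold (𝓡 n) ∞ N]

/-- The chart reading of a map and its derivative. -/
theorem hasFDerivAt_map_in_charts {pr : M → N} (hpr : ContMDiff (𝓡 d) (𝓡 n) ∞ pr) (c : M) (c' : N)
    {x : EuclideanSpace ℝ (Fin d)} (hx : x ∈ (extChartAt (𝓡 d) c).target)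
    (hx' : pr ((extChartAt (𝓡 d) c).symm x) ∈ (extChartAt (𝓡 n) c').source) :
    ContDiffAt ℝ ∞ (fun y ↦ extChartAt (𝓡 n) c' (pr ((extChartAt (𝓡 d) c).symm y))) x ∧
      ∀ b, fderiv ℝ (fun y ↦ extChartAt (𝓡 n) c' (pr ((extChartAt (𝓡 d) c).symm y))) x b =
        chartDeriv c' (pr ((extChartAt (𝓡 d) c).symm x))
          (mfderiv (𝓡 d) (𝓡 n) pr ((extChartAt (𝓡 d) c).symm x) (chartInvDeriv c x b)) := by
  have h1 : ContMDiffAt (𝓡 d) (𝓡 d) ∞ (extChartAt (𝓡 d) c).symm x :=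
    (contMDiffOn_symm_target c).contMDiffAt ((isOpen_extChartAt_target c).mem_nhds hx)
  have h2 : ContMDiffAt (𝓡 n) (𝓡 n) ∞ (extChartAt (𝓡 n) c')
      (pr ((extChartAt (𝓡 d) c).symm x)) :=
    contMDiffAt_extChartAt' (by rwa [extChartAt_source] at hx')
  have h3 : ContMDiffAt (𝓡 d) (𝓡 n) ∞ (fun y ↦ pr ((extChartAt (𝓡 d) c).symm y)) x :=
    (hpr _).comp x h1
  refine ⟨(h2.comp x h3).contDiffAt, fun b ↦ ?_⟩
  have e1 := mfderiv_comp_apply (I := 𝓡 d) (I' := 𝓡 n) (I'' := 𝓡 n) x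
    (h2.mdifferentiableAt (by simp)) (h3.mdifferentiableAt (by simp)) b
  have e2 := mfderiv_comp_apply (I := 𝓡 d) (I' := 𝓡 d) (I'' := 𝓡 n) x
    ((hpr _).mdifferentiableAt (by simp)) (h1.mdifferentiableAt (by simp)) b
  rw [mfderiv_eq_fderiv] at e1
  exact e1.trans (congrArg (chartDeriv c' (pr ((extChartAt (𝓡 d) c).symm x))) e2)

variable [RiemannianBundle (fun p : M ↦ TangentSpace (𝓡 d) p)]
  [IsContMDiffRiemannianBundle (𝓡 d) ∞ (EuclideanSpace ℝ (Fin d))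
      (fun p : M ↦ TangentSpace (𝓡 d) p)]
  [RiemannianBundle (fun q : N ↦ TangentSpace (𝓡 n) q)]
  [IsContMDiffRiemannianBundle (𝓡 n) ∞ (EuclideanSpace ℝ (Fin n))
      (fun q : N ↦ TangentSpace (𝓡 n) q)]

/-- For a Riemannian submersion and a vertical vector field `X`, `g(∇_v X, v) = 0` for all
horizontal vectors `v`. -/
theorem inner_covDeriv_vertical_eq_zero {pr : M → N}
    (hpr : IsRiemannianSubmersion (d := d) (n := n) pr) {X : ∀ p : M, TangentSpace (𝓡 d) p}
    (hX : IsSmoothVectorField X) (hvert : ∀ p, X p ∈ vertical (d := d) (n := n) pr p) (p : M)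
    {v : TangentSpace (𝓡 d) p} (hv : v ∈ horizontal (d := d) (n := n) pr p) :
    inner ℝ (covDeriv X p v) v = 0 := by
  have hp := mem_extChartAt_source (I := 𝓡 d) p
  have hx := (extChartAt (𝓡 d) p).map_source hp
  set x := extChartAt (𝓡 d) p p
  have hpx : (extChartAt (𝓡 d) p).symm x = p := (extChartAt (𝓡 d) p).left_inv hp
  let P : EuclideanSpace ℝ (Fin d) → EuclideanSpace ℝ (Fin n) :=
    fun y ↦ extChartAt (𝓡 n) (pr p) (pr ((extChartAt (𝓡 d) p).symm y))
  have hq : pr ((extChartAt (𝓡 d) p).symm x) ∈ (extChartAt (𝓡 n) (pr p)).source := by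
    rw [hpx]
    exact mem_extChartAt_source (I := 𝓡 n) (pr p)
  have hcont : ContinuousAt (fun y ↦ pr ((extChartAt (𝓡 d) p).symm y)) x :=
    hpr.smooth.continuous.continuousAt.comp
      ((contMDiffOn_symm_target p).continuousOn.continuousAt
        ((isOpen_extChartAt_target p).mem_nhds hx))
  have hnear : ∀ᶠ y in nhds x, y ∈ (extChartAt (𝓡 d) p).target ∧
      pr ((extChartAt (𝓡 d) p).symm y) ∈ (extChartAt (𝓡 n) (pr p)).source :=
    ((isOpen_extChartAt_target p).eventually_mem hx).and
      (hcont.eventually ((isOpen_extChartAt_source (pr p)).mem_nhds hq))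
  have hDP : ∀ y, y ∈ (extChartAt (𝓡 d) p).target →
      pr ((extChartAt (𝓡 d) p).symm y) ∈ (extChartAt (𝓡 n) (pr p)).source → ∀ b,
      metricInChart (pr p) (P y) (fderiv ℝ P y b) (fderiv ℝ P y b) =
        ‖mfderiv (𝓡 d) (𝓡 n) pr ((extChartAt (𝓡 d) p).symm y) (chartInvDeriv p y b)‖ ^ 2 :=
    fun y hy hy' b ↦ by
      rw [(hasFDerivAt_map_in_charts hpr.smooth p (pr p) hy hy').2, ← real_inner_self_eq_norm_sq]
      exact metricInChart_mfderiv (pr p) hy' _ _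
  have hgv : ∀ y b : EuclideanSpace ℝ (Fin d),
      metricInChart p y b b = ‖chartInvDeriv p y b‖ ^ 2 := fun y b ↦ by
    rw [← real_inner_self_eq_norm_sq]
    rfl
  have hdiff := differentiableAt_metricInChart p hx
  have hmain := lieDeriv_eq_zero_of_touching (h := metricInChart (pr p)) (P := P)
    (X := fieldInChart p X) (v := chartDeriv p p v) hdiff
    ((hasFDerivAt_map_in_charts hpr.smooth p (pr p) hx hq).1.of_le (by norm_cast))
    (differentiableAt_metricInChart (pr p) ((extChartAt (𝓡 n) (pr p)).map_source hq))
    (differentiableAt_fieldInChart p hX hx)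
    (hnear.mono fun y hy ↦ by
      rw [(hasFDerivAt_map_in_charts hpr.smooth p (pr p) hy.1 hy.2).2,
        mfderiv_symm_fieldInChart p X hy.1]
      have h : mfderiv (𝓡 d) (𝓡 n) pr ((extChartAt (𝓡 d) p).symm y)
        (X ((extChartAt (𝓡 d) p).symm y)) = 0 := hvert _
      rw [h, map_zero])
    (hnear.mono fun y hy b ↦ by
      rw [hDP y hy.1 hy.2, hgv]
      exact pow_le_pow_left₀ (norm_nonneg _) (hpr.norm_mfderiv_le _ _) 2)
    (by
      rw [hDP x hx hq, hgv]
      have h1 := apply_symm_mfderiv_symm p hp (fun q z ↦ ‖mfderiv (𝓡 d) (𝓡 n) pr q z‖ ^ 2) v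
      have h2 := apply_symm_mfderiv_symm p hp (fun q z ↦ ‖z‖ ^ 2) v
      rw [hpr.norm_mfderiv_of_horizontal p hv] at h1
      exact h1.trans h2.symm)
  have hsymm := Filter.Eventually.of_forall (f := nhds x) fun z ↦ metricInChart_symm p z
  have hcov := inner_covDeriv X p v v
  -- With this formula `g(∇_v X, v)` is half the Lie derivative of `g` along `X` on `v`, which
  -- `hmain` shows to be zero.
  have hchr := christoffelForm_apply_first hdiff hsymm (chartDeriv p p v) (fieldInChart p X x)
  rw [metricInChart_symm p x (chartDeriv p p v)] at hmain
  have hcov' : inner ℝ (covDeriv X p v) v =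
      metricInChart p x (fderiv ℝ (fieldInChart p X) x (chartDeriv p p v)) (chartDeriv p p v) +
      christoffelForm (metricInChart p) x (chartDeriv p p v) (fieldInChart p X x)
        (chartDeriv p p v) := hcov
  rw [hcov', hchr]
  linarith

/-- An anti-invariant Riemannian submersion from a Kenmotsu manifold has no vertical `ξ`. -/
theorem not_hasVerticalReeb {S : AlmostContactMetricStructure d M} (hS : S.IsKenmotsu)
    (hdim : 2 ≤ d) {pr : M → N} (hpr : IsRiemannianSubmersion (d := d) (n := n) pr)
    (hanti : IsAntiInvariant (n := n) S pr) (p : M) : ¬ HasVerticalReeb (n := n) S pr := by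
  intro hReeb
  obtain ⟨v, hv, hv0⟩ := exists_horizontal_ne_zero hanti hdim p
  have h1 := inner_covDeriv_vertical_eq_zero hpr S.smooth_xi hReeb p hv
  have h2 : S.eta p v = 0 := by
    rw [S.eta_eq_inner]
    exact hv _ (hReeb p)
  rw [hS.inner_covDeriv_xi, h2] at h1
  have h3 : 0 < ‖v‖ ^ 2 := pow_pos (norm_pos_iff.2 hv0) 2
  linarith

end VerticalReeb

end KenmotsuSubmersion

/-! ### The main theorem. -/

open KenmotsuSubmersion in
theorem mainTheorem6 {m n : ℕ} (hm : 1 ≤ m)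
    {M : Type*} [TopologicalSpace M] [T2Space M] [SecondCountableTopology M]
    [ChartedSpace (EuclideanSpace ℝ (Fin (2 * m + 1))) M] [IsManifold (𝓡 (2 * m + 1)) ∞ M]
    [RiemannianBundle (fun p : M ↦ TangentSpace (𝓡 (2 * m + 1)) p)]
    [IsContMDiffRiemannianBundle (𝓡 (2 * m + 1)) ∞ (EuclideanSpace ℝ (Fin (2 * m + 1)))
      (fun p : M ↦ TangentSpace (𝓡 (2 * m + 1)) p)]
    {N : Type*} [TopologicalSpace N] [T2Space N] [SecondCountableTopology N]
    [ChartedSpace (EuclideanSpace ℝ (Fin n)) N] [IsManifold (𝓡 n) ∞ N]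
    [RiemannianBundle (fun q : N ↦ TangentSpace (𝓡 n) q)]
    [IsContMDiffRiemannianBundle (𝓡 n) ∞ (EuclideanSpace ℝ (Fin n))
      (fun q : N ↦ TangentSpace (𝓡 n) q)]
    (S : AlmostContactMetricStructure (2 * m + 1) M) (hS : S.IsKenmotsu)
    (pr : M → N) (hpr : IsRiemannianSubmersion (d := 2 * m + 1) (n := n) pr)
    (hanti : IsAntiInvariant (n := n) S pr)
    (hReeb : HasVerticalReeb (n := n) S pr ∨ HasHorizontalReeb (n := n) S pr)
    (f : M → ℝ) (hf : MDifferentiable (𝓡 (2 * m + 1)) 𝓘(ℝ, ℝ) f)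
    (hclairaut : IsClairautWith (d := 2 * m + 1) (n := n) pr (fun p ↦ Real.exp (f p))) :
    ∀ p : M, inner ℝ (grad (d := 2 * m + 1) f p) (S.xi p) = 1 := by
  intro p
  rcases hReeb with h | h
  · exact absurd h (not_hasVerticalReeb hS (by omega) hpr hanti p)
  · exact inner_grad_xi_of_horizontal hS hpr.dim_lt h hf hclairaut p
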